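/- Let $\mathbf p=(p_i)_{i\ge 1}$ be a probability distribution on the positive integers, and let $X_1,X_2,\dots$ be i.i.d. random variables with $\mathbb P(X_1=i)=p_i$ for every $i\ge 1$. For $n\ge 1$ let $L_n$ be the length of a longest strictly increasing subsequence of $(X_1,\dots,X_n)$, i.e. the largest $k$ for which there are indices $1\le i_1<\dots<i_k\le n$ with $X_{i_1}<\dots<X_{i_k}$. For $t>0$ let $w_t$ be the unique positive solution of $$w_t=\sum_{i\ge 1}\frac{t p_i}{t p_i+w_t}.$$ Then for every $\varepsilon\in(0,1)$, every $n\ge 1$ and every distribution $\mathbf p$ on the positive integers, $$\mathbb P\bigl(L_n\le (1-\varepsilon)\,w_n\bigr)\le 3\exp\Bigl(-\frac{\varepsilon^2(1-\varepsilon)}{40}\,w_n\Bigr).$$ -/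

import Mathlib

open MeasureTheory ProbabilityTheory

/-- The positive integers carry the discrete σ-algebra. -/
instance instMeasurableSpacePNat : MeasurableSpace ℕ+ := ⊤

instance instDiscreteMeasurableSpacePNat : DiscreteMeasurableSpace ℕ+ := ⟨fun _ => trivial⟩

/-- The length of a longest strictly increasing subsequence of `x 0, …, x (n - 1)`: the largest `k`
for which there are indices `i 0 < ⋯ < i (k - 1)` with `x (i 0) < ⋯ < x (i (k - 1))`.
The set below contains `0` and is bounded above by `n`, so the supremum is a maximum. -/
noncomputable def lisLength {α : Type*} [Preorder α] {n : ℕ} (x : Fin n → α) : ℕ :=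
  sSup {k : ℕ | ∃ i : Fin k → Fin n, StrictMono i ∧ StrictMono (x ∘ i)}

/-- `w` is a positive real number with `w = ∑_{i ≥ 1} t p_i / (t p_i + w)` (convergent series). -/
def IsPositiveFixedPoint (p : PMF ℕ+) (t w : ℝ) : Prop :=
  0 < w ∧ HasSum (fun i : ℕ+ => t * (p i).toReal / (t * (p i).toReal + w)) w

theorem PMF.hasSum_toReal_pnat (p : PMF ℕ+) : HasSum (fun i : ℕ+ => (p i).toReal) 1 := by
  have h := (ENNReal.hasSum_toReal (f := fun i => p i) (by simp [p.tsum_coe]))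
  rwa [← ENNReal.tsum_toReal_eq (fun i => p.apply_ne_top i), p.tsum_coe, ENNReal.toReal_one] at h

/-- Existence and uniqueness of the positive solution of `w = ∑ a_i / (a_i + w)` for a nonnegative,
summable, nonzero family `a`. -/
theorem existsUnique_hasSum_div_add {a : ℕ+ → ℝ} {t : ℝ} (ht : 0 < t) (ha : HasSum a t)
    (ha0 : ∀ i, 0 ≤ a i) (i₀ : ℕ+) (hai : 0 < a i₀) :
    ∃! w : ℝ, 0 < w ∧ HasSum (fun i : ℕ+ => a i / (a i + w)) w := by
  have bd : ∀ d w : ℝ, 0 < d → d ≤ w → ∀ i, a i / (a i + w) ≤ a i / d := by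
    intro d w hd hw i
    exact div_le_div_of_nonneg_left (ha0 i) hd (by linarith [ha0 i])
  have nn : ∀ w : ℝ, 0 < w → ∀ i, 0 ≤ a i / (a i + w) := by
    intro w hw i
    exact div_nonneg (ha0 i) (by linarith [ha0 i])
  have sm : ∀ w : ℝ, 0 < w → Summable (fun i => a i / (a i + w)) := fun w hw =>
    Summable.of_nonneg_of_le (nn w hw) (bd w w hw le_rfl) (ha.summable.div_const w)
  have hd : 0 < a i₀ / (a i₀ + 1) := by positivity
  set d := a i₀ / (a i₀ + 1) with hd_def
  have hd1 : d ≤ 1 := by rw [hd_def, div_le_one (by positivity)]; linarith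
  have cont : ContinuousOn (fun w => w - ∑' i, a i / (a i + w)) (Set.Icc d (1 + t)) := by
    refine continuousOn_id.sub (continuousOn_tsum (u := fun i => a i / d) ?_
      (ha.summable.div_const d) ?_)
    · intro i
      refine continuousOn_const.div (by fun_prop) ?_
      intro w hw
      have := hw.1
      have := ha0 i
      exact ne_of_gt (by linarith)
    · intro i w hw
      rw [Real.norm_of_nonneg (nn w (hd.trans_le hw.1) i)]
      exact bd d w hd hw.1 i
  have h0 : d - ∑' i, a i / (a i + d) ≤ 0 := by
    have h1 := (sm d hd).le_tsum i₀ (fun j _ => nn d hd j)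
    have h2 : d ≤ a i₀ / (a i₀ + d) :=
      div_le_div_of_nonneg_left hai.le (by linarith) (by linarith)
    linarith
  have h1 : 0 ≤ (1 + t) - ∑' i, a i / (a i + (1 + t)) := by
    have h2 := (sm (1 + t) (by linarith)).tsum_le_tsum
      (bd (1 + t) (1 + t) (by linarith) le_rfl) (ha.summable.div_const _)
    rw [(ha.div_const (1 + t)).tsum_eq] at h2
    have h3 : t / (1 + t) ≤ 1 := by rw [div_le_one (by linarith)]; linarith
    linarith
  obtain ⟨w, hw, hw0⟩ := intermediate_value_Icc (by linarith) cont ⟨h0, h1⟩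
  have hwpos : 0 < w := hd.trans_le hw.1
  have hw1 : ∑' i, a i / (a i + w) = w := by
    have : w - ∑' i, a i / (a i + w) = 0 := hw0
    linarith
  have mono : ∀ u v : ℝ, 0 < u → u ≤ v → HasSum (fun i => a i / (a i + u)) u →
      HasSum (fun i => a i / (a i + v)) v → v ≤ u := by
    intro u v hu huv hsu hsv
    refine hasSum_le (fun i => ?_) hsv hsu
    exact div_le_div_of_nonneg_left (ha0 i) (by linarith [ha0 i]) (by linarith)
  refine ⟨w, ⟨hwpos, ?_⟩, ?_⟩
  · have := (sm w hwpos).hasSum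
    rwa [hw1] at this
  · rintro v ⟨hv, hsv⟩
    have hsw : HasSum (fun i => a i / (a i + w)) w := by
      have := (sm w hwpos).hasSum
      rwa [hw1] at this
    rcases le_total v w with h | h
    · exact le_antisymm h (mono v w hv h hsv hsw)
    · exact le_antisymm (mono w v hwpos h hsw hsv) h

/-- For `t > 0` the equation has exactly one positive solution. -/
theorem existsUnique_isPositiveFixedPoint (p : PMF ℕ+) {t : ℝ} (ht : 0 < t) :
    ∃! w : ℝ, IsPositiveFixedPoint p t w := by
  have ha : HasSum (fun i : ℕ+ => t * (p i).toReal) t := by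
    simpa using p.hasSum_toReal_pnat.mul_left t
  obtain ⟨i₀, hi₀⟩ := p.support_nonempty
  have hai : 0 < t * (p i₀).toReal :=
    mul_pos ht (ENNReal.toReal_pos ((p.mem_support_iff i₀).1 hi₀) (p.apply_ne_top i₀))
  exact existsUnique_hasSum_div_add ht ha (fun i => by positivity) i₀ hai

open Classical in
/-- For `t > 0`, the unique positive solution `w_t` of `w = ∑_{i ≥ 1} t p_i / (t p_i + w)`
(and `0` for `t ≤ 0`, where `w_t` is not defined). -/
noncomputable def wSol (p : PMF ℕ+) (t : ℝ) : ℝ :=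
  if ht : 0 < t then (existsUnique_isPositiveFixedPoint p ht).choose else 0

theorem wSol_spec (p : PMF ℕ+) {t : ℝ} (ht : 0 < t) : IsPositiveFixedPoint p t (wSol p t) := by
  rw [wSol, dif_pos ht]
  exact (existsUnique_isPositiveFixedPoint p ht).choose_spec.1

/-! A randomised online selection already builds a long enough increasing subsequence. At threshold
`c` a clock rings with probability `θ` at each step; when it rings, each value `i` in `[c, K)` is
flagged with probability `q i`, and the least flagged `x` is taken, after which the threshold is `x
+ 1`. This is realisable because `x` is requested with probability at most `θ * q x ≤ ν {x}`. With
flags kept fixed, the number of letters taken would be `min A B`, with `A` binomial `(n, θ)` and `B`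
an independent sum of Bernoulli `(q i)`; redrawing them only helps. Since `u ^ min A B ≤ u ^ A + u ^
B - u ^ (A + B)`, the moment is controlled by two product generating functions (`lisMoment_le`). For
`θ = w / n` and `q i = n p_i / (n p_i + w)`, `A` has mean `w`, and so does `B` up to truncation:
this is the fixed-point equation. Markov's inequality with `u = 1 - ε` concludes. -/

/-- The length of a longest strictly increasing sublist of `l` with entries at least `c`. -/
def lisFrom : ℕ → List ℕ → ℕ
  | _, [] => 0
  | c, x :: l => if c ≤ x then max (lisFrom (x + 1) l + 1) (lisFrom c l) else lisFrom c l

theorem exists_sublist_length_eq_lisFrom (l : List ℕ) (c : ℕ) :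
    ∃ s : List ℕ, s.Sublist l ∧ s.Pairwise (· < ·) ∧ (∀ a ∈ s, c ≤ a) ∧
      s.length = lisFrom c l := by
  induction l generalizing c with
  | nil => exact ⟨[], by simp [lisFrom]⟩
  | cons x l ih =>
    obtain ⟨s, hs, hp, hc, hl⟩ := ih c
    obtain ⟨s', hs', hp', hc', hl'⟩ := ih (x + 1)
    have skip : ∃ s : List ℕ, s.Sublist (x :: l) ∧ s.Pairwise (· < ·) ∧ (∀ a ∈ s, c ≤ a) ∧
        s.length = lisFrom c l := ⟨s, hs.cons x, hp, hc, hl⟩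
    rw [lisFrom]
    split_ifs with h
    · rcases max_choice (lisFrom (x + 1) l + 1) (lisFrom c l) with hm | hm <;> rw [hm]
      · refine ⟨x :: s', hs'.cons_cons x, List.pairwise_cons.2 ⟨fun a ha => hc' a ha, hp'⟩, ?_,
          by simp [hl']⟩
        intro a ha
        rcases List.mem_cons.1 ha with rfl | ha
        · exact h
        · have := hc' a ha
          omega
      · exact skip
    · exact skip

/-! ### Moment recursion and its solution -/

/-- Split the generating function of the number of flagged values according to the least one; the
subtracted product is the event of no flag. -/
theorem sum_mul_prod_one_sub (q : ℕ → ℝ) (u : ℝ) {c K : ℕ} (h : c ≤ K) :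
    ∑ x ∈ Finset.Ico c K, q x * (∏ i ∈ Finset.Ico c x, (1 - q i)) *
        (u * ∏ i ∈ Finset.Ico (x + 1) K, (1 - q i * (1 - u))) =
      ∏ i ∈ Finset.Ico c K, (1 - q i * (1 - u)) - ∏ i ∈ Finset.Ico c K, (1 - q i) := by
  induction K, h using Nat.le_induction with
  | base => simp
  | succ K h ih =>
    rw [Finset.sum_Ico_succ_top h, Finset.prod_Ico_succ_top h, Finset.prod_Ico_succ_top h]
    have e : ∑ x ∈ Finset.Ico c K, q x * (∏ i ∈ Finset.Ico c x, (1 - q i)) *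
        (u * ∏ i ∈ Finset.Ico (x + 1) (K + 1), (1 - q i * (1 - u))) =
        (∑ x ∈ Finset.Ico c K, q x * (∏ i ∈ Finset.Ico c x, (1 - q i)) *
        (u * ∏ i ∈ Finset.Ico (x + 1) K, (1 - q i * (1 - u)))) * (1 - q K * (1 - u)) := by
      rw [Finset.sum_mul]
      refine Finset.sum_congr rfl fun x hx => ?_
      rw [Finset.prod_Ico_succ_top (Finset.mem_Ico.1 hx).2]
      ring
    rw [e, ih]
    simp
    ring

/-- The expectation of `u ^ L`, where `L` is the length of a longest strictly increasing sequence
of letters at least `c` in a word of `m` independent letters with law `ν`. -/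
noncomputable def lisMoment (ν : Measure ℕ) (u : ℝ) (m c : ℕ) : ℝ :=
  ∫ x, u ^ lisFrom c (List.ofFn x) ∂(Measure.pi fun _ : Fin m => ν)

theorem integrable_pow_nat {α : Type*} [MeasurableSpace α] [DiscreteMeasurableSpace α]
    (η : Measure α) [IsFiniteMeasure η] {u : ℝ} (hu0 : 0 ≤ u) (hu1 : u ≤ 1) (f : α → ℕ) :
    Integrable (fun x => u ^ f x) η := by
  refine Integrable.of_bound Measurable.of_discrete.aestronglyMeasurable 1
    (ae_of_all _ fun x => ?_)
  rw [Real.norm_of_nonneg (pow_nonneg hu0 _)]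
  exact pow_le_one₀ hu0 hu1

/-- Condition on the first letter: `r x` is the probability that it equals `x` and is taken. Taking
and skipping both bound the moment from above, hence so does any mixture. -/
theorem lisMoment_succ_le {ν : Measure ℕ} [IsProbabilityMeasure ν] {u : ℝ}
    (hu0 : 0 ≤ u) (hu1 : u ≤ 1) (m c K : ℕ) (r : ℕ → ℝ)
    (hr0 : ∀ x, 0 ≤ r x) (hr : ∀ x, r x ≤ ν.real {x}) :
    lisMoment ν u (m + 1) c ≤ (1 - ∑ x ∈ Finset.Ico c K, r x) * lisMoment ν u m c +
      ∑ x ∈ Finset.Ico c K, r x * (u * lisMoment ν u m (x + 1)) := by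
  have hcons : lisMoment ν u (m + 1) c =
      ∫ x, ∫ y : Fin m → ℕ, u ^ lisFrom c (x :: List.ofFn y) ∂(Measure.pi fun _ => ν) ∂ν := by
    have h := (measurePreserving_piFinSuccAbove (fun _ : Fin (m + 1) => ν) 0).symm
    rw [lisMoment, ← h.integral_comp (MeasurableEquiv.measurableEmbedding _)]
    rw [integral_prod]
    · simp [List.ofFn_succ]
    · exact integrable_pow_nat _ hu0 hu1 _
  -- Probability of taking `x` once it appears. When `ν {x} = 0` the quotient is `0`, harmlessly,
  -- since then `r x = 0`.
  set a : ℕ → ℝ := fun x => r x / ν.real {x}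
  have ha0 : ∀ x, 0 ≤ a x := fun x => div_nonneg (hr0 x) measureReal_nonneg
  have ha1 : ∀ x, a x ≤ 1 := fun x => div_le_one_of_le₀ (hr x) measureReal_nonneg
  have hra : ∀ x, ν.real {x} * a x = r x := by
    intro x
    rcases eq_or_ne (ν.real {x}) 0 with h | h
    · rw [h, zero_mul]
      exact le_antisymm (hr0 x) (h ▸ hr x)
    · exact mul_div_cancel₀ _ h
  have hpt : ∀ x, ∫ y : Fin m → ℕ, u ^ lisFrom c (x :: List.ofFn y) ∂(Measure.pi fun _ => ν) ≤
      lisMoment ν u m c + ∑ y ∈ Finset.Ico c K,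
        ({y} : Set ℕ).indicator
          (fun _ => a y * (u * lisMoment ν u m (y + 1) - lisMoment ν u m c)) x := by
    intro x
    have hskip : ∫ y : Fin m → ℕ, u ^ lisFrom c (x :: List.ofFn y) ∂(Measure.pi fun _ => ν) ≤
        lisMoment ν u m c := by
      refine integral_mono (integrable_pow_nat _ hu0 hu1 _) (integrable_pow_nat _ hu0 hu1 _) ?_
      intro y
      refine pow_le_pow_of_le_one hu0 hu1 ?_
      rw [lisFrom]
      split_ifs <;> simp
    by_cases hx : x ∈ Finset.Ico c K
    · have htake : ∫ y : Fin m → ℕ, u ^ lisFrom c (x :: List.ofFn y) ∂(Measure.pi fun _ => ν) ≤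
          u * lisMoment ν u m (x + 1) := by
        rw [lisMoment, ← integral_const_mul]
        refine integral_mono (integrable_pow_nat _ hu0 hu1 _)
          ((integrable_pow_nat _ hu0 hu1 _).const_mul u) ?_
        intro y
        simp only [← pow_succ']
        refine pow_le_pow_of_le_one hu0 hu1 ?_
        rw [lisFrom, if_pos (Finset.mem_Ico.1 hx).1]
        exact le_max_left _ _
      rw [Finset.sum_eq_single_of_mem x hx (fun y _ hy => by simp [hy.symm])]
      simp only [Set.mem_singleton_iff, Set.indicator_of_mem]
      nlinarith [ha0 x, ha1 x, mul_le_mul_of_nonneg_left htake (ha0 x),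
        mul_le_mul_of_nonneg_left hskip (sub_nonneg.2 (ha1 x))]
    · rw [Finset.sum_eq_zero, add_zero]
      · exact hskip
      · intro y hy
        exact Set.indicator_of_notMem (fun h => hx (by rwa [Set.mem_singleton_iff.1 h])) _
  have hint : ∀ y ∈ Finset.Ico c K, Integrable (({y} : Set ℕ).indicator
      (fun _ => a y * (u * lisMoment ν u m (y + 1) - lisMoment ν u m c))) ν :=
    fun y _ => (integrable_const _).indicator (MeasurableSet.of_discrete)
  calc lisMoment ν u (m + 1) c ≤ ∫ x, (lisMoment ν u m c + ∑ y ∈ Finset.Ico c K,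
        ({y} : Set ℕ).indicator
          (fun _ => a y * (u * lisMoment ν u m (y + 1) - lisMoment ν u m c)) x) ∂ν := by
        rw [hcons]
        refine integral_mono_of_nonneg
          (ae_of_all _ fun x => integral_nonneg fun _ => pow_nonneg hu0 _)
          ((integrable_const _).add (integrable_finsetSum _ hint)) (ae_of_all _ hpt)
    _ = lisMoment ν u m c + ∑ y ∈ Finset.Ico c K,
          r y * (u * lisMoment ν u m (y + 1) - lisMoment ν u m c) := by
        rw [integral_add (integrable_const _) (integrable_finsetSum _ hint),
          integral_finsetSum _ hint]
        simp only [integral_const, probReal_univ, one_smul]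
        congr 1
        refine Finset.sum_congr rfl fun y _ => ?_
        rw [integral_indicator_const _ MeasurableSet.of_discrete, smul_eq_mul, ← mul_assoc, hra]
    _ = _ := by
        simp only [mul_sub, Finset.sum_sub_distrib, ← Finset.sum_mul]
        ring

/-- Induction on `m` with `r x = θ * q x * Z x`, where `q x * Z x` is the chance that `x` is the
least flagged value. The bound equals `a + b - a * b` for the generating functions `a`, `b` of the
clock and the flags. -/
theorem lisMoment_le {ν : Measure ℕ} [IsProbabilityMeasure ν] {u : ℝ}
    (hu0 : 0 ≤ u) (hu1 : u ≤ 1) {θ : ℝ} (hθ0 : 0 ≤ θ) (hθ1 : θ ≤ 1)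
    {q : ℕ → ℝ} (hq0 : ∀ i, 0 ≤ q i) (hq1 : ∀ i, q i ≤ 1) (hq : ∀ i, θ * q i ≤ ν.real {i})
    (m : ℕ) {c K : ℕ} (hc : c ≤ K) :
    lisMoment ν u m c ≤ 1 - (1 - (1 - θ * (1 - u)) ^ m) *
      (1 - ∏ i ∈ Finset.Ico c K, (1 - q i * (1 - u))) := by
  induction m generalizing c with
  | zero => simp [lisMoment, lisFrom]
  | succ m ih =>
    set Z : ℕ → ℝ := fun x => ∏ i ∈ Finset.Ico c x, (1 - q i)
    set Q : ℕ → ℝ := fun x => ∏ i ∈ Finset.Ico x K, (1 - q i * (1 - u))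
    set b : ℝ := (1 - θ * (1 - u)) ^ m with hb
    have hZ0 : ∀ x, 0 ≤ Z x := fun x => Finset.prod_nonneg fun i _ => sub_nonneg.2 (hq1 i)
    have hZ1 : ∀ x, Z x ≤ 1 := fun x =>
      Finset.prod_le_one (fun i _ => sub_nonneg.2 (hq1 i)) (fun i _ => by linarith [hq0 i])
    have hZQ : Z K ≤ Q c := Finset.prod_le_prod (fun i _ => sub_nonneg.2 (hq1 i))
      (fun i _ => by nlinarith [hq0 i, mul_nonneg (hq0 i) hu0])
    have hQ1 : Q c ≤ 1 := Finset.prod_le_one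
      (fun i _ => by nlinarith [hq0 i, hq1 i, mul_nonneg (hq0 i) hu0])
      (fun i _ => by nlinarith [mul_nonneg (hq0 i) (sub_nonneg.2 hu1)])
    have hβ0 : 0 ≤ 1 - θ * (1 - u) := by nlinarith
    have hβ1 : 1 - θ * (1 - u) ≤ 1 := by nlinarith
    have hb0 : 0 ≤ b := pow_nonneg hβ0 m
    have hb1 : b ≤ 1 := pow_le_one₀ hβ0 hβ1
    have hs1 : ∑ x ∈ Finset.Ico c K, θ * q x * Z x = θ * (1 - Z K) := by
      have := sum_mul_prod_one_sub q 1 hc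
      simp only [sub_self, mul_zero, sub_zero, Finset.prod_const_one, mul_one] at this
      rw [← this, Finset.mul_sum]
      exact Finset.sum_congr rfl fun x _ => mul_assoc _ _ _
    have hs2 : ∑ x ∈ Finset.Ico c K, θ * q x * Z x * (u * Q (x + 1)) = θ * (Q c - Z K) := by
      rw [← sum_mul_prod_one_sub q u hc, Finset.mul_sum]
      exact Finset.sum_congr rfl fun x _ => by ring
    have hr0 : ∀ x, 0 ≤ θ * q x * Z x := fun x =>
      mul_nonneg (mul_nonneg hθ0 (hq0 x)) (hZ0 x)
    refine (lisMoment_succ_le hu0 hu1 m c K (fun x => θ * q x * Z x) hr0 fun x =>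
      (mul_le_of_le_one_right (mul_nonneg hθ0 (hq0 x)) (hZ1 x)).trans (hq x)).trans ?_
    have h1 : (1 - ∑ x ∈ Finset.Ico c K, θ * q x * Z x) * lisMoment ν u m c ≤
        (1 - θ * (1 - Z K)) * (1 - (1 - b) * (1 - Q c)) := by
      rw [hs1]
      exact mul_le_mul_of_nonneg_left (ih hc) (by nlinarith [hZ0 K, hZ1 K])
    have h2 : ∑ x ∈ Finset.Ico c K, θ * q x * Z x * (u * lisMoment ν u m (x + 1)) ≤
        u * b * (θ * (1 - Z K)) + (1 - b) * (θ * (Q c - Z K)) := by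
      rw [← hs1, ← hs2, Finset.mul_sum, Finset.mul_sum, ← Finset.sum_add_distrib]
      refine Finset.sum_le_sum fun x hx => ?_
      have := mul_le_mul_of_nonneg_left (ih (Finset.mem_Ico.1 hx).2)
        (mul_nonneg (hr0 x) hu0)
      calc _ = θ * q x * Z x * u * lisMoment ν u m (x + 1) := by ring
        _ ≤ _ := this
        _ = _ := by ring
    refine (add_le_add h1 h2).trans ?_
    rw [pow_succ, ← hb]
    -- This is exactly the slack in the inductive step.
    have key : 0 ≤ θ * ((1 - u) * (b * (Q c - Z K)) + (1 - b) * (Z K * (1 - Q c))) :=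
      mul_nonneg hθ0 (add_nonneg
        (mul_nonneg (sub_nonneg.2 hu1) (mul_nonneg hb0 (sub_nonneg.2 hZQ)))
        (mul_nonneg (sub_nonneg.2 hb1) (mul_nonneg (hZ0 K) (sub_nonneg.2 hQ1))))
    change _ ≤ 1 - (1 - b * (1 - θ * (1 - u))) * (1 - Q c)
    linear_combination key

/-! ### From the moment to the tail -/

theorem lisFrom_ofFn_le_lisLength {n : ℕ} (x : Fin n → ℕ+) (c : ℕ) :
    lisFrom c (List.ofFn fun i => (x i : ℕ)) ≤ lisLength x := by
  obtain ⟨s, hs, hp, -, hl⟩ := exists_sublist_length_eq_lisFrom (List.ofFn fun i => (x i : ℕ)) c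
  obtain ⟨f, hf⟩ := List.sublist_iff_exists_fin_orderEmbedding_get_eq.1 hs
  have hlen : (List.ofFn fun i => (x i : ℕ)).length = n := List.length_ofFn
  refine le_csSup ⟨n, ?_⟩ ?_
  · rintro k ⟨i, hi, -⟩
    simpa using Fintype.card_le_of_injective i hi.injective
  · rw [← hl]
    refine ⟨fun j => Fin.cast hlen (f j), fun a b hab => f.strictMono hab, fun a b hab => ?_⟩
    have h : s.get a < s.get b := hp.rel_get_of_lt hab
    rw [hf, hf, List.get_ofFn, List.get_ofFn] at h
    exact_mod_cast h

/-- The exponential Markov inequality for `lisMoment`. -/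
theorem rpow_mul_measureReal_lisFrom_le (ν : Measure ℕ) [IsProbabilityMeasure ν] {u : ℝ}
    (hu0 : 0 < u) (hu1 : u ≤ 1) (n c : ℕ) (a : ℝ) :
    u ^ a * (Measure.pi fun _ : Fin n => ν).real {x | (lisFrom c (List.ofFn x) : ℝ) ≤ a} ≤
      lisMoment ν u n c := by
  refine le_trans ?_ (mul_meas_ge_le_integral_of_nonneg (ae_of_all _ fun _ => pow_nonneg hu0.le _)
    (integrable_pow_nat _ hu0.le hu1 _) (u ^ a))
  refine mul_le_mul_of_nonneg_left (measureReal_mono fun x hx => ?_) (Real.rpow_nonneg hu0.le a)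
  rw [Set.mem_ofPred_eq, ← Real.rpow_natCast]
  exact Real.rpow_le_rpow_of_exponent_ge hu0 hu1 hx

theorem one_sub_prod_le_exp_add_exp {θ u : ℝ} (hu1 : u ≤ 1) (hu0 : 0 ≤ u) (hθ0 : 0 ≤ θ)
    (hθ1 : θ ≤ 1) {q : ℕ → ℝ} (hq0 : ∀ i, 0 ≤ q i) (hq1 : ∀ i, q i ≤ 1) (m : ℕ) (s : Finset ℕ) :
    1 - (1 - (1 - θ * (1 - u)) ^ m) * (1 - ∏ i ∈ s, (1 - q i * (1 - u))) ≤
      Real.exp (-(m * θ * (1 - u))) + Real.exp (-((∑ i ∈ s, q i) * (1 - u))) := by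
  have hfac : ∀ r : ℝ, 0 ≤ r → r ≤ 1 → 0 ≤ 1 - r * (1 - u) := fun r h0 h1 => by nlinarith
  have hexp : ∀ r : ℝ, 1 - r * (1 - u) ≤ Real.exp (-(r * (1 - u))) := fun r => by
    linarith [Real.add_one_le_exp (-(r * (1 - u)))]
  have h1 : (1 - θ * (1 - u)) ^ m ≤ Real.exp (-(m * θ * (1 - u))) := by
    refine (pow_le_pow_left₀ (hfac θ hθ0 hθ1) (hexp θ) m).trans_eq ?_
    rw [← Real.exp_nat_mul]
    congr 1
    ring
  have h2 : ∏ i ∈ s, (1 - q i * (1 - u)) ≤ Real.exp (-((∑ i ∈ s, q i) * (1 - u))) := by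
    refine (Finset.prod_le_prod (fun i _ => hfac _ (hq0 i) (hq1 i))
      (fun i _ => hexp (q i))).trans_eq ?_
    rw [← Real.exp_sum, Finset.sum_neg_distrib, Finset.sum_mul]
  have h3 : 0 ≤ (1 - θ * (1 - u)) ^ m := pow_nonneg (hfac θ hθ0 hθ1) m
  have h4 : 0 ≤ ∏ i ∈ s, (1 - q i * (1 - u)) :=
    Finset.prod_nonneg fun i _ => hfac _ (hq0 i) (hq1 i)
  nlinarith [mul_nonneg h3 h4]

/-- With `s = √(1 - ε)`, the bound `log s ≥ 1 - 1 / s` makes the right side at least `(1 - s) ^ 2 ≥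
ε ^ 2 / 4`, so `40` is generous. -/
theorem sq_mul_div_forty_le {ε : ℝ} (hε₀ : 0 < ε) (hε₁ : ε < 1) :
    ε ^ 2 * (1 - ε) / 40 ≤ ε + (1 - ε) * Real.log (1 - ε) := by
  obtain ⟨s, hs0, hs⟩ : ∃ s : ℝ, 0 < s ∧ s ^ 2 = 1 - ε :=
    ⟨√(1 - ε), Real.sqrt_pos.2 (by linarith), Real.sq_sqrt (by linarith)⟩
  have hlog : 1 - s⁻¹ ≤ Real.log s := Real.one_sub_inv_le_log_of_pos hs0
  have hs1 : s < 1 := by nlinarith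
  have hε : ε = 1 - s ^ 2 := by linarith
  have h1 : s ^ 2 * (1 - s⁻¹) = s ^ 2 - s := by field_simp
  have h2 : s ^ 2 - s ≤ s ^ 2 * Real.log s := h1 ▸ mul_le_mul_of_nonneg_left hlog (sq_nonneg s)
  have h3 : (1 - s) ^ 2 ≤ ε + (1 - ε) * Real.log (1 - ε) := by
    rw [← hs, Real.log_pow, hε]
    push_cast
    linarith
  refine le_trans ?_ h3
  have h4 : ε ^ 2 ≤ 4 * (1 - s) ^ 2 := by
    rw [hε]
    nlinarith [mul_nonneg (sq_nonneg (1 - s)) (by nlinarith : 0 ≤ 4 - (1 + s) ^ 2)]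
  nlinarith [mul_nonneg (sq_nonneg ε) hε₀.le]

/-- Each term is at most `t * p_i / w`. For `t = n ≥ 1` this yields `w ≤ n`, so `w / n` is a
probability. -/
theorem IsPositiveFixedPoint.sq_le {p : PMF ℕ+} {t w : ℝ} (h : IsPositiveFixedPoint p t w)
    (ht : 0 ≤ t) : w ^ 2 ≤ t := by
  obtain ⟨hw, hs⟩ := h
  have := hasSum_le (fun i => ?_) hs ((p.hasSum_toReal_pnat.mul_left t).div_const w)
  · rw [mul_one, le_div_iff₀ hw] at this
    nlinarith
  · exact div_le_div_of_nonneg_left (by positivity) hw (le_add_of_nonneg_left (by positivity))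

/-- Finitely many letters carry all but an arbitrarily small part of the fixed-point series. -/
theorem IsPositiveFixedPoint.exists_sum_Ico_ge {p : PMF ℕ+} {t w : ℝ}
    (h : IsPositiveFixedPoint p t w) (ht : 0 ≤ t) {P : ℕ → ℝ} (hP0 : ∀ i, 0 ≤ P i)
    (hP : ∀ i : ℕ+, P i = (p i).toReal) {δ : ℝ} (hδ : 0 < δ) :
    ∃ K, w - δ ≤ ∑ i ∈ Finset.Ico 0 K, t * P i / (t * P i + w) := by
  obtain ⟨hw, hs⟩ := h
  obtain ⟨s, hs⟩ := (hs.eventually (lt_mem_nhds (sub_lt_self w hδ))).exists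
  refine ⟨(s.image fun i : ℕ+ => (i : ℕ)).sup id + 1, hs.le.trans ?_⟩
  have e : ∑ i ∈ s, t * (p i).toReal / (t * (p i).toReal + w) =
      ∑ i ∈ s.image (fun i : ℕ+ => (i : ℕ)), t * P i / (t * P i + w) := by
    rw [Finset.sum_image fun a _ b _ hab => PNat.coe_injective hab]
    simp only [hP]
  rw [e]
  refine Finset.sum_le_sum_of_subset_of_nonneg (fun i hi => ?_) fun i _ _ => ?_
  · exact Finset.mem_Ico.2 ⟨i.zero_le, Nat.lt_succ_of_le (Finset.le_sup (f := id) hi)⟩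
  · have := mul_nonneg ht (hP0 i)
    positivity

theorem proposition5p2 {Ω : Type*} [MeasurableSpace Ω] (μ : Measure Ω) [IsProbabilityMeasure μ]
    (p : PMF ℕ+) (X : ℕ → Ω → ℕ+) (hX : ∀ i, Measurable (X i))
    (hlaw : ∀ i, μ.map (X i) = p.toMeasure) (hindep : iIndepFun X μ)
    (ε : ℝ) (hε₀ : 0 < ε) (hε₁ : ε < 1) (n : ℕ) (hn : 1 ≤ n) :
    μ.real {ω | (lisLength (fun i : Fin n => X i ω) : ℝ) ≤ (1 - ε) * wSol p n} ≤
      3 * Real.exp (-(ε ^ 2 * (1 - ε) / 40 * wSol p n)) := by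
  have hn0 : (1 : ℝ) ≤ n := by exact_mod_cast hn
  have hfix := wSol_spec p (t := n) (by linarith)
  set w := wSol p n
  have hw : 0 < w := hfix.1
  have hwn : w ≤ n := by nlinarith [hfix.sq_le (by linarith)]
  have hcoe : Measurable fun i : ℕ+ => (i : ℕ) := Measurable.of_discrete
  set ν : Measure ℕ := p.toMeasure.map fun i : ℕ+ => (i : ℕ)
  have : IsProbabilityMeasure ν := Measure.isProbabilityMeasure_map hcoe.aemeasurable
  have hY : ∀ i : Fin n, Measurable fun ω => (X i ω : ℕ) := fun i => hcoe.comp (hX i)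
  have hpi : μ.map (fun ω (i : Fin n) => (X i ω : ℕ)) = Measure.pi fun _ => ν := by
    have h := (hindep.precomp (g := fun i : Fin n => (i : ℕ)) Fin.val_injective).comp
      (fun _ i => (i : ℕ)) fun _ => hcoe
    refine ((iIndepFun_iff_map_fun_eq_pi_map fun i => (hY i).aemeasurable).1 h).trans ?_
    congr 1
    funext i
    change μ.map ((fun i : ℕ+ => (i : ℕ)) ∘ X i) = ν
    rw [← Measure.map_map hcoe (hX i), hlaw]
  have hP : ∀ i : ℕ+, ν.real {(i : ℕ)} = (p i).toReal := by
    intro i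
    rw [map_measureReal_apply hcoe MeasurableSet.of_discrete, measureReal_def]
    have : (fun i : ℕ+ => (i : ℕ)) ⁻¹' {(i : ℕ)} = {i} := by
      ext j
      simp
    rw [this, p.toMeasure_apply_singleton _ MeasurableSet.of_discrete]
  have hP0 : ∀ i, 0 ≤ ν.real {i} := fun _ => measureReal_nonneg
  -- A truncation loss of `log 2 / ε` costs a factor `2` in `exp (-(w * ε))`; with the clock term
  -- this makes the constant `3 = 1 + 2`.
  obtain ⟨K, hK⟩ := hfix.exists_sum_Ico_ge (by linarith) hP0 hP
    (div_pos (Real.log_pos one_lt_two) hε₀)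
  set q : ℕ → ℝ := fun i => n * ν.real {i} / (n * ν.real {i} + w)
  have hnP : ∀ i, 0 ≤ n * ν.real {i} := fun i => mul_nonneg (by linarith) (hP0 i)
  have hq0 : ∀ i, 0 ≤ q i := fun i => div_nonneg (hnP i) (by linarith [hnP i])
  have hq1 : ∀ i, q i ≤ 1 := fun i => div_le_one_of_le₀ (by linarith) (by linarith [hnP i])
  have hq : ∀ i, w / n * q i ≤ ν.real {i} := by
    intro i
    have e : w / n * q i = ν.real {i} * (w / (n * ν.real {i} + w)) := by
      have := hnP i
      simp only [q]
      field_simp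
    rw [e]
    exact mul_le_of_le_one_right (hP0 i)
      (div_le_one_of_le₀ (by linarith [hnP i]) (by linarith [hnP i]))
  have hθ0 : 0 ≤ w / n := by positivity
  have hθ1 : w / n ≤ 1 := div_le_one_of_le₀ hwn (by linarith)
  have hu0 : 0 < 1 - ε := by linarith
  have hmoment : lisMoment ν (1 - ε) n 0 ≤ 3 * Real.exp (-(w * ε)) := by
    refine ((lisMoment_le hu0.le (by linarith) hθ0 hθ1 hq0 hq1 hq n K.zero_le).trans
      (one_sub_prod_le_exp_add_exp (by linarith) hu0.le hθ0 hθ1 hq0 hq1 n _)).trans ?_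
    have h1 : (n : ℝ) * (w / n) * (1 - (1 - ε)) = w * ε := by
      field_simp
      ring
    have h2 : Real.exp (-((∑ i ∈ Finset.Ico 0 K, q i) * (1 - (1 - ε)))) ≤
        2 * Real.exp (-(w * ε)) := by
      rw [← Real.exp_log two_pos, ← Real.exp_add, Real.exp_le_exp, sub_sub_cancel]
      have h3 := mul_le_mul_of_nonneg_right hK hε₀.le
      rw [sub_mul, div_mul_cancel₀ _ hε₀.ne'] at h3
      linarith
    rw [h1]
    linarith
  have hevent : μ.real {ω | (lisLength (fun i : Fin n => X i ω) : ℝ) ≤ (1 - ε) * w} ≤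
      (Measure.pi fun _ : Fin n => ν).real
        {x | (lisFrom 0 (List.ofFn x) : ℝ) ≤ (1 - ε) * w} := by
    rw [← hpi, map_measureReal_apply (measurable_pi_lambda _ hY) MeasurableSet.of_discrete]
    refine measureReal_mono fun ω hω => ?_
    have h : (lisLength (fun i : Fin n => X i ω) : ℝ) ≤ (1 - ε) * w := hω
    exact le_trans (by exact_mod_cast lisFrom_ofFn_le_lisLength (fun i : Fin n => X i ω) 0) h
  have hmarkov := rpow_mul_measureReal_lisFrom_le ν hu0 (by linarith) n 0 ((1 - ε) * w)
  rw [← le_div_iff₀' (Real.rpow_pos_of_pos hu0 _)] at hmarkov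
  refine hevent.trans (hmarkov.trans ((div_le_div_of_nonneg_right hmoment
    (Real.rpow_nonneg hu0.le _)).trans ?_))
  rw [Real.rpow_def_of_pos hu0, mul_div_assoc, ← Real.exp_sub]
  refine mul_le_mul_of_nonneg_left (Real.exp_le_exp.2 ?_) (by norm_num)
  nlinarith [mul_le_mul_of_nonneg_right (sq_mul_div_forty_le hε₀ hε₁) hw.le]
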